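/- Let $m,n\ge 2$, let $p_1,\dots,p_n$ be homogeneous polynomials of degree $m$ in $z=(z_1,\dots,z_n)$ over $\mathbb C$, and let $\mathbf P:\mathbb C^n\to\mathbb C^n$, $z\mapsto(p_1(z),\dots,p_n(z))$. Let $\mathcal O_n$ be the algebra of germs at the origin of holomorphic functions on $\mathbb C^n$, and let $I\subset\mathcal O_n$ be the ideal generated by the germs of $p_1,\dots,p_n$. Assume that $\dim_{\mathbb C}\mathcal O_n/I<\infty$, and let $\mathcal A$ be any commutative associative unital $\mathbb C$-algebra isomorphic to $\mathcal O_n/I$. Then $\mathcal A$ is local; denote its maximal ideal by $\mathfrak m$. The following holds. (1) $n=\dim_{\mathbb C}\mathfrak m/\mathfrak m^2$. (2) There is a largest integer $\nu$ with $\mathfrak m^\nu\ne 0$ (the nil-index of $\mathfrak m$); it is divisible by $n$, and $m=\nu/n+1$. (3) Let $f=(f_1,\dots,f_n)$ be any basis of any complement to $\mathfrak m^2$ in $\mathfrak m$. Let $q_1,\dots,q_K$ be all the monomials of degree $m$ in $n$ variables, where $K=\binom{m+n-1}{m}$, and put $q=(q_1,\dots,q_K)$. Let $\mathcal S$ be any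 complement to $\mathfrak m^{m+1}$ in $\mathfrak m^m$, and let $\pi:\mathfrak m^m\to\mathcal S$ be the projection with kernel $\mathfrak m^{m+1}$. Then there exists an $n\times K$ complex matrix $\Gamma=(\gamma_{\sigma\rho})$ with linearly independent rows such that $$\sum_{\rho=1}^K\gamma_{\sigma\rho}\,\pi(q_\rho(f))=0,\qquad \sigma=1,\dots,n.$$ Moreover, for every such matrix $\Gamma$ the map $\Phi:\mathbb C^n\to\mathbb C^n$, $\Phi(z)=\Gamma q(z)$, is linearly equivalent to $\mathbf P$, that is, $\mathbf P=L_1\circ\Phi\circ L_2$ for some invertible linear transformations $L_1,L_2$ of $\mathbb C^n$. -/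

import Mathlib

open scoped Topology

noncomputable section

namespace FinitePolyMap

/-- Complex-valued functions on `ℂⁿ` that are holomorphic near the origin. -/
def holoAtZero (n : ℕ) : Subalgebra ℂ ((Fin n → ℂ) → ℂ) where
  carrier := {g | AnalyticAt ℂ g 0}
  mul_mem' ha hb := AnalyticAt.mul ha hb
  add_mem' ha hb := AnalyticAt.add ha hb
  algebraMap_mem' c := analyticAt_const (v := c)

/-- The functions in `holoAtZero n` that vanish identically near the origin, i.e. those
whose germ at the origin is zero. -/
def zeroGerms (n : ℕ) : Ideal (holoAtZero n) where
  carrier := {g | ∀ᶠ z in 𝓝 (0 : Fin n → ℂ), g.1 z = 0}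
  zero_mem' := Filter.Eventually.of_forall fun _ => rfl
  add_mem' {a b} ha hb := by
    filter_upwards [ha, hb] with z h1 h2
    change a.1 z + b.1 z = 0
    rw [h1, h2, add_zero]
  smul_mem' c a ha := by
    filter_upwards [ha] with z h
    change c.1 z * a.1 z = 0
    rw [h, mul_zero]

/-- The algebra `𝒪ₙ` of germs at the origin of holomorphic functions on `ℂⁿ`: two functions
are identified when they agree near the origin. -/
def HoloGerm (n : ℕ) : Type := holoAtZero n ⧸ zeroGerms n

instance (n : ℕ) : CommRing (HoloGerm n) := Ideal.Quotient.commRing (zeroGerms n)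

instance (n : ℕ) : Algebra ℂ (HoloGerm n) := Ideal.Quotient.algebra ℂ (I := zeroGerms n)

/-- The germ at the origin of a polynomial. -/
def polyGerm {n : ℕ} (p : MvPolynomial (Fin n) ℂ) : HoloGerm n :=
  Ideal.Quotient.mk (zeroGerms n)
    ⟨fun z => MvPolynomial.eval z p, AnalyticOnNhd.eval_mvPolynomial p 0 (Set.mem_univ _)⟩

/-- The ideal of `𝒪ₙ` generated by the germs of `p₁, …, pₙ`. -/
def germIdeal {n : ℕ} (p : Fin n → MvPolynomial (Fin n) ℂ) : Ideal (HoloGerm n) :=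
  Ideal.span (Set.range fun r => polyGerm (p r))

/-- The algebra `𝒪ₙ / (p₁, …, pₙ)`. -/
def GermAlg {n : ℕ} (p : Fin n → MvPolynomial (Fin n) ℂ) : Type :=
  HoloGerm n ⧸ germIdeal p

instance {n : ℕ} (p : Fin n → MvPolynomial (Fin n) ℂ) : CommRing (GermAlg p) :=
  Ideal.Quotient.commRing (germIdeal p)

instance {n : ℕ} (p : Fin n → MvPolynomial (Fin n) ℂ) : Algebra ℂ (GermAlg p) :=
  Ideal.Quotient.algebra ℂ (I := germIdeal p)

/-- The map `ℂⁿ → ℂⁿ` with components `p₁, …, pₙ`. -/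
def polyMap {n : ℕ} (p : Fin n → MvPolynomial (Fin n) ℂ) : (Fin n → ℂ) → (Fin n → ℂ) :=
  fun z r => MvPolynomial.eval z (p r)

/-- `Φ₂ = L₁ ∘ Φ₁ ∘ L₂` for some non-degenerate linear transformations `L₁`, `L₂`. -/
def LinearlyEquivalent {n : ℕ} (Φ₁ Φ₂ : (Fin n → ℂ) → (Fin n → ℂ)) : Prop :=
  ∃ L₁ L₂ : (Fin n → ℂ) ≃ₗ[ℂ] (Fin n → ℂ), Φ₂ = L₁ ∘ Φ₁ ∘ L₂

/-- `ν` is the nil-index of `𝔪`: the largest integer `μ` with `𝔪 ^ μ ≠ 0`. -/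
def IsNilIndex {B : Type*} [CommRing B] (𝔪 : Ideal B) (ν : ℕ) : Prop :=
  IsGreatest {μ : ℕ | 𝔪 ^ μ ≠ ⊥} ν

/-- The ideal `J`, intersected with the ideal `I`, as a complex subspace of `I`. -/
def subspaceIn {B : Type*} [CommRing B] [Algebra ℂ B] (I J : Ideal B) : Submodule ℂ I :=
  (J.restrictScalars ℂ).comap ((Submodule.subtype I).restrictScalars ℂ)

/-- Exponent vectors of the monomials of degree `m` in `n` variables. -/
abbrev MonoIdx (n m : ℕ) : Type := {d : Fin n → ℕ // d ∈ Finset.piAntidiag Finset.univ m}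

/-- The value at `x` of the monomial `q_ρ` of degree `m` in `n` variables. -/
def mono {n m : ℕ} {R : Type*} [CommRing R] (ρ : MonoIdx n m) (x : Fin n → R) : R :=
  ∏ i, x i ^ ρ.1 i

theorem mono_mem {n m : ℕ} {B : Type*} [CommRing B] (I : Ideal B) (ρ : MonoIdx n m)
    (x : Fin n → I) : mono ρ (fun i => (x i : B)) ∈ I ^ m := by
  have h : ∑ i, ρ.1 i = m := (Finset.mem_piAntidiag.1 ρ.2).1
  have h' : mono ρ (fun i => (x i : B)) ∈ ∏ i, I ^ ρ.1 i :=
    Ideal.prod_mem_prod fun i _ => Ideal.pow_mem_pow (x i).2 _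
  rwa [Finset.prod_pow_eq_pow_sum, h] at h'

/-- The value of the degree `m` monomial `q_ρ` at a tuple of elements of `I`, as an element
of `I ^ m`. -/
def monoIn {n m : ℕ} {B : Type*} [CommRing B] (I : Ideal B) (ρ : MonoIdx n m)
    (x : Fin n → I) : ↥(I ^ m) :=
  ⟨mono ρ (fun i => (x i : B)), mono_mem I ρ x⟩

/-- The rows of `Γ` are `n` linearly independent linear relations among the vectors
`π (q_ρ (f))`, where `π : 𝔪 ^ m → S` is the projection onto the complement `S` of
`𝔪 ^ (m + 1)` in `𝔪 ^ m`, with kernel `𝔪 ^ (m + 1)`. -/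
def IsRelationMatrix {n m : ℕ} {B : Type*} [CommRing B] [Algebra ℂ B] (𝔪 : Ideal B)
    (f : Fin n → 𝔪) (S : Submodule ℂ ↥(𝔪 ^ m))
    (hS : IsCompl S (subspaceIn (𝔪 ^ m) (𝔪 ^ (m + 1))))
    (Γ : Matrix (Fin n) (MonoIdx n m) ℂ) : Prop :=
  LinearIndependent ℂ Γ.row ∧
    ∀ σ, ∑ ρ, Γ σ ρ • Submodule.projectionOnto S _ hS (monoIn 𝔪 ρ f) = 0

/-- The reconstructed map `z ↦ Γ q(z)`. -/
def recMap {n m : ℕ} (Γ : Matrix (Fin n) (MonoIdx n m) ℂ) : (Fin n → ℂ) → (Fin n → ℂ) :=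
  fun z => Γ.mulVec fun ρ => mono ρ z

end FinitePolyMap

end

/-!
Since the `p r` are homogeneous and generate an ideal of finite colength, that ideal contains a
power of the ideal `(x₁, …, xₙ)`, so convergent power series may be replaced by polynomials:
`𝒪ₙ / (p)` is `ℂ[x₁, …, xₙ] / (p)`.

A quotient of the polynomial ring by a regular sequence of `n` forms of degree `m` has the same
Hilbert function as `ℂ[x₁, …, xₙ] / (x₁ᵐ, …, xₙᵐ)`. The span of the `p r` contains such a sequence:
`Extⁱ(ℂ[x] / (p), ℂ[x])` vanishes for `i < n`, as `(p)` contains a power of `(x₁, …, xₙ)`, and prime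
avoidance over an infinite field turns this vanishing into regular elements chosen one at a time.
Comparing dimensions in degree `m` shows that the sequence generates `(p)` and that the `p r` are
linearly independent; comparing dimensions in high degrees gives the nil-index `n (m - 1)`.

Modulo `𝔪 ^ (m + 1)` only the linear parts of the `f i` matter for the degree `m` monomials in `f`.
These linear parts form an invertible substitution `c`, because `(p)` lies in `(x₁, …, xₙ) ^ 2`. A
form `g` of degree `m` is therefore a relation among these monomials exactly if `g ∘ c` lies in the
span of the `p r`, so that `n` independent relations determine this span, and hence `p` up to
linear equivalence.
-/

namespace FinitePolyMap

section RegularSequences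

open CategoryTheory Abelian RingTheory.Sequence

variable {K R : Type*} [Field K] [Infinite K] [CommRing R] [IsNoetherianRing R] [Algebra K R]

theorem exists_isSMulRegular_mem_of_subsingleton_linearMap (V : Submodule K R) (M : Type*)
    [AddCommGroup M] [Module R M] [Module.Finite R M]
    [Subsingleton ((R ⧸ Ideal.span (V : Set R)) →ₗ[R] M)] :
    ∃ y ∈ V, IsSMulRegular M y := by
  have not_le (Q : associatedPrimes R M) : ¬ (V : Set R) ⊆ Q.1 := fun hle ↦ by
    replace hle := Ideal.span_le.2 hle
    obtain ⟨hprime, f, hf⟩ := (isAssociatedPrime_iff_exists_injective_linearMap Q.1 M).1 Q.2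
    have hzero : f ∘ₗ Submodule.factor hle = 0 := Subsingleton.elim _ _
    have hone : f (Submodule.Quotient.mk 1) = 0 :=
      LinearMap.congr_fun hzero (Submodule.Quotient.mk 1)
    rw [map_eq_zero_iff f hf, Submodule.Quotient.mk_eq_zero] at hone
    exact hprime.ne_top (Q.1.eq_top_iff_one.2 hone)
  have := (associatedPrimes.finite R M).to_subtype
  by_contra! hV
  have hcover : ⋃ Q : associatedPrimes R M,
      (((Q.1.restrictScalars K).comap V.subtype : Submodule K V) : Set V) = Set.univ := by
    refine Set.eq_univ_of_forall fun y ↦ ?_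
    have hy : (y : R) ∈ ⋃ Q ∈ associatedPrimes R M, (Q : Set R) := by
      rw [biUnion_associatedPrimes_eq_compl_regular]
      exact hV y y.2
    simpa using hy
  obtain ⟨Q, hQ⟩ := Subspace.exists_eq_top_of_iUnion_eq_univ hcover
  exact not_le Q (Submodule.comap_subtype_eq_top.1 hQ)

theorem exists_isWeaklyRegular_of_subsingleton_ext (V : Submodule K R) (k : ℕ) (M : ModuleCat R)
    [Module.Finite R M]
    (hExt : ∀ i < k, Subsingleton (Ext (ModuleCat.of R (R ⧸ Ideal.span (V : Set R))) M i)) :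
    ∃ rs : List R, rs.length = k ∧ (∀ r ∈ rs, r ∈ V) ∧ IsWeaklyRegular M rs := by
  induction k generalizing M with
  | zero => exact ⟨[], rfl, by simp, .nil R M⟩
  | succ k ih =>
    set N := ModuleCat.of R (R ⧸ Ideal.span (V : Set R))
    have : Subsingleton (N →ₗ[R] M) :=
      (Ext.addEquiv₀.trans ModuleCat.homAddEquiv).symm.subsingleton_congr.2 (hExt 0 k.succ_pos)
    obtain ⟨y, hyV, hy⟩ := exists_isSMulRegular_mem_of_subsingleton_linearMap V M
    have hExt' : ∀ i < k, Subsingleton (Ext N (ModuleCat.of R (QuotSMulTop y M)) i) := fun i hi ↦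
      AddCommGrpCat.subsingleton_of_isZero <| ShortComplex.Exact.isZero_of_both_zeros
        (Ext.covariant_sequence_exact₃' N hy.smulShortComplex_shortExact i (i + 1) rfl)
        ((AddCommGrpCat.isZero_of_iff_subsingleton.2 (hExt i (by lia))).eq_zero_of_src _)
        ((AddCommGrpCat.isZero_of_iff_subsingleton.2 (hExt (i + 1) (by lia))).eq_zero_of_tgt _)
    obtain ⟨rs, hlen, hmem, hreg⟩ := ih (ModuleCat.of R (QuotSMulTop y M)) hExt'
    exact ⟨y :: rs, by simp [hlen], by simpa [hyV] using hmem,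
      (isWeaklyRegular_cons_iff M y rs).2 ⟨hy, hreg⟩⟩

end RegularSequences

section WeaklyRegularSequences

open MvPolynomial RingTheory.Sequence

theorem isWeaklyRegular_append_singleton_iff {R : Type*} [CommRing R] {rs : List R} {r : R} :
    IsWeaklyRegular R (rs ++ [r]) ↔
      IsWeaklyRegular R rs ∧ ∀ a, r * a ∈ Ideal.ofList rs → a ∈ Ideal.ofList rs := by
  rw [isWeaklyRegular_append_iff, isWeaklyRegular_singleton_iff,
    isSMulRegular_quotient_iff_mem_of_smul_mem]
  simp only [smul_eq_mul, Ideal.mul_top]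

variable {σ K : Type*}

theorem mem_span_X_pow_image [CommSemiring K] {s : Set σ} {m : ℕ} {f : MvPolynomial σ K} :
    f ∈ Ideal.span ((fun i ↦ (X i : MvPolynomial σ K) ^ m) '' s) ↔
      ∀ d ∈ f.support, ∃ i ∈ s, m ≤ d i := by
  have himage : (fun i ↦ (X i : MvPolynomial σ K) ^ m) '' s =
      (fun d ↦ monomial d (1 : K)) '' ((fun i ↦ Finsupp.single i m) '' s) := by
    simp only [Set.image_image, X_pow_eq_monomial]
  simp [himage, mem_ideal_span_monomial_image]

theorem ofList_map_X_pow [CommSemiring K] (l : List σ) (m : ℕ) :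
    Ideal.ofList (l.map fun i ↦ (X i : MvPolynomial σ K) ^ m) =
      Ideal.span ((fun i ↦ X i ^ m) '' {i | i ∈ l}) := by
  simp [Ideal.ofList, Set.image]

theorem isWeaklyRegular_map_X_pow [CommRing K] {l : List σ} (hl : l.Nodup) (m : ℕ) :
    IsWeaklyRegular (MvPolynomial σ K) (l.map fun i ↦ (X i : MvPolynomial σ K) ^ m) := by
  induction l using List.reverseRecOn with
  | nil => exact .nil _ _
  | append_singleton l i ih =>
    obtain ⟨hl, -, hi⟩ := List.nodup_append.1 hl
    rw [List.map_append, List.map_singleton, isWeaklyRegular_append_singleton_iff,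
      ofList_map_X_pow]
    refine ⟨ih hl, fun a ha ↦ mem_span_X_pow_image.2 fun d hd ↦ ?_⟩
    obtain ⟨j, hj, hmj⟩ := mem_span_X_pow_image.1 ha (Finsupp.single i m + d) (by
      rw [X_pow_eq_monomial, mem_support_iff, coeff_monomial_mul, one_mul]
      exact mem_support_iff.1 hd)
    have hij : i ≠ j := fun h ↦ hi j hj i (by simp) h.symm
    exact ⟨j, hj, by simpa [Finsupp.single_apply, hij] using hmj⟩

theorem mem_idealOfVars_iff [CommSemiring K] {f : MvPolynomial σ K} :
    f ∈ idealOfVars σ K ↔ constantCoeff f = 0 := by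
  simpa [constantCoeff_eq, Finsupp.degree_eq_zero_iff] using mem_pow_idealOfVars_iff' 1 f

theorem isMaximal_idealOfVars [Field K] : (idealOfVars σ K).IsMaximal := by
  have eq_ker : idealOfVars σ K = RingHom.ker (constantCoeff : MvPolynomial σ K →+* K) :=
    Ideal.ext fun _ ↦ mem_idealOfVars_iff
  rw [eq_ker]
  exact RingHom.ker_isMaximal_of_surjective _ fun a ↦ ⟨C a, by simp⟩

variable [Fintype σ]

theorem ofList_map_X_pow_univ [CommSemiring K] (m : ℕ) :
    Ideal.ofList (Finset.univ.toList.map fun i ↦ (X i : MvPolynomial σ K) ^ m) =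
      Ideal.span (Set.range fun i ↦ X i ^ m) := by
  simp [ofList_map_X_pow]

variable [Field K]

theorem subsingleton_ext_of_pow_idealOfVars_le {P : Ideal (MvPolynomial σ K)} {N : ℕ}
    (hN : idealOfVars σ K ^ N ≤ P) {i : ℕ} (hi : i < Fintype.card σ) :
    Subsingleton (CategoryTheory.Abelian.Ext
      (ModuleCat.of (MvPolynomial σ K) (MvPolynomial σ K ⧸ P))
      (ModuleCat.of (MvPolynomial σ K) (MvPolynomial σ K)) i) := by
  have lt_top : idealOfVars σ K • (⊤ : Ideal (MvPolynomial σ K)) < ⊤ := by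
    simpa using isMaximal_idealOfVars.ne_top.lt_top
  have support_le : Module.support (MvPolynomial σ K) (MvPolynomial σ K ⧸ P) ⊆
      PrimeSpectrum.zeroLocus (idealOfVars σ K) := by
    rw [Module.support_eq_zeroLocus, Ideal.annihilator_quotient,
      PrimeSpectrum.zeroLocus_subset_zeroLocus_iff]
    exact fun f hf ↦ ⟨N, hN (Ideal.pow_mem_pow hf N)⟩
  have ofList_vars : Ideal.ofList (Finset.univ.toList.map fun i ↦ (X i : MvPolynomial σ K) ^ 1) =
      idealOfVars σ K := by
    rw [ofList_map_X_pow_univ]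
    simp
  refine ModuleCat.subsingleton_ext_of_exists_isRegular (idealOfVars σ K) _ support_le _ lt_top
    (Finset.univ.toList.map fun i ↦ X i ^ 1) ?_ ?_ i (by simpa)
  · exact fun r hr ↦ ofList_vars ▸ Ideal.subset_span hr
  · refine ⟨isWeaklyRegular_map_X_pow (Finset.nodup_toList _) 1, ?_⟩
    rw [ofList_vars]
    exact lt_top.ne'

theorem exists_isWeaklyRegular_of_pow_idealOfVars_le [Infinite K]
    {V : Submodule K (MvPolynomial σ K)} {N : ℕ}
    (hN : idealOfVars σ K ^ N ≤ Ideal.span (V : Set (MvPolynomial σ K))) :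
    ∃ rs : List (MvPolynomial σ K), rs.length = Fintype.card σ ∧ (∀ r ∈ rs, r ∈ V) ∧
      IsWeaklyRegular (MvPolynomial σ K) rs :=
  exists_isWeaklyRegular_of_subsingleton_ext V _ (ModuleCat.of _ _) fun _ hi ↦
    subsingleton_ext_of_pow_idealOfVars_le hN hi

end WeaklyRegularSequences

section HilbertFunction

open MvPolynomial RingTheory.Sequence

attribute [local instance] MvPolynomial.gradedAlgebra

variable {σ K : Type*} {m d : ℕ}

section CommRing

variable [CommRing K] {q : MvPolynomial σ K} {J : Ideal (MvPolynomial σ K)}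

theorem homogeneousComponent_add_mul (hq : q.IsHomogeneous m) (a : MvPolynomial σ K) (d : ℕ) :
    homogeneousComponent (m + d) (q * a) = q * homogeneousComponent d a := by
  simp only [← decomposition.decompose'_apply]
  exact DirectSum.coe_decompose_mul_add_of_left_mem (homogeneousSubmodule σ K) hq

theorem homogeneousComponent_mul_of_lt (hq : q.IsHomogeneous m) (a : MvPolynomial σ K)
    (hd : d < m) : homogeneousComponent d (q * a) = 0 := by
  rw [← decomposition.decompose'_apply]
  exact DirectSum.coe_decompose_mul_of_left_mem_of_not_le (homogeneousSubmodule σ K) hq hd.not_ge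

theorem isHomogeneous_span {s : Set (MvPolynomial σ K)} (hs : ∀ f ∈ s, f.IsHomogeneous m) :
    (Ideal.span s).IsHomogeneous (homogeneousSubmodule σ K) :=
  Ideal.homogeneous_span _ _ fun f hf ↦ ⟨m, hs f hf⟩

theorem mem_pow_idealOfVars_of_isHomogeneous {f : MvPolynomial σ K} (hf : f.IsHomogeneous d) :
    f ∈ idealOfVars σ K ^ d :=
  (mem_pow_idealOfVars_iff' d f).2 fun _ hx ↦ hf.coeff_eq_zero hx.ne

theorem span_le_pow_idealOfVars {s : Set (MvPolynomial σ K)} (hs : ∀ f ∈ s, f.IsHomogeneous m) :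
    Ideal.span s ≤ idealOfVars σ K ^ m :=
  Ideal.span_le.2 fun f hf ↦ mem_pow_idealOfVars_of_isHomogeneous (hs f hf)

theorem mem_of_mem_sup_pow_idealOfVars (hJ : J.IsHomogeneous (homogeneousSubmodule σ K))
    {f : MvPolynomial σ K} {k : ℕ} (hf : f ∈ J ⊔ idealOfVars σ K ^ k) (hdeg : f.totalDegree < k) :
    f ∈ J := by
  obtain ⟨g, hg, h, hh, rfl⟩ := Submodule.mem_sup.1 hf
  refine (mem_iff_homogeneousComponent_mem hJ _).2 fun i ↦ ?_
  rcases lt_or_ge i k with hi | hi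
  · have : homogeneousComponent i h = 0 := homogeneousComponent_eq_zero' _ _ fun x hx hxi ↦ by
      have := (mem_pow_idealOfVars_iff k h).1 hh x hx
      lia
    rw [map_add, this, add_zero]
    exact homogeneousComponent_mem_of_mem hJ hg i
  · rw [homogeneousComponent_eq_zero _ _ (hdeg.trans_le hi)]
    exact J.zero_mem

/-- The degree `d` part `J_d` of an ideal `J` of a polynomial ring, as a submodule over the
coefficient ring. The Hilbert function of a homogeneous ideal `J` is recorded through the
dimensions of the `J_d` rather than those of the quotients. -/
noncomputable def degComp (J : Ideal (MvPolynomial σ K)) (d : ℕ) : Submodule K (MvPolynomial σ K) :=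
  homogeneousSubmodule σ K d ⊓ J.restrictScalars K

theorem degComp_mono {J J' : Ideal (MvPolynomial σ K)} (h : J ≤ J') (d : ℕ) :
    degComp J d ≤ degComp J' d :=
  inf_le_inf_left _ h

theorem degComp_eq_homogeneousSubmodule_iff :
    degComp J d = homogeneousSubmodule σ K d ↔ ∀ f : MvPolynomial σ K, f.IsHomogeneous d → f ∈ J :=
  inf_eq_left

theorem degComp_sup_span_singleton_of_lt (hJ : J.IsHomogeneous (homogeneousSubmodule σ K))
    (hq : q.IsHomogeneous m) (hd : d < m) : degComp (J ⊔ Ideal.span {q}) d = degComp J d := by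
  refine le_antisymm ?_ (degComp_mono le_sup_left d)
  rintro f ⟨hf, hfJ⟩
  refine ⟨hf, ?_⟩
  obtain ⟨g, hg, b, hb, rfl⟩ := Submodule.mem_sup.1 hfJ
  obtain ⟨a, rfl⟩ := Ideal.mem_span_singleton.1 hb
  rw [← homogeneousComponent_eq_self hf, map_add, homogeneousComponent_mul_of_lt hq a hd, add_zero]
  exact homogeneousComponent_mem_of_mem hJ hg d

theorem degComp_sup_span_singleton_add (hJ : J.IsHomogeneous (homogeneousSubmodule σ K))
    (hq : q.IsHomogeneous m) (d : ℕ) :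
    degComp (J ⊔ Ideal.span {q}) (m + d) =
      degComp J (m + d) ⊔ (homogeneousSubmodule σ K d).map (LinearMap.mulLeft K q) := by
  refine le_antisymm ?_ (sup_le (degComp_mono le_sup_left _) ?_)
  · rintro f ⟨hf, hfJ⟩
    obtain ⟨g, hg, b, hb, rfl⟩ := Submodule.mem_sup.1 hfJ
    obtain ⟨a, rfl⟩ := Ideal.mem_span_singleton.1 hb
    rw [← homogeneousComponent_eq_self hf, map_add, homogeneousComponent_add_mul hq]
    exact Submodule.add_mem_sup
      ⟨homogeneousComponent_isHomogeneous _ g, homogeneousComponent_mem_of_mem hJ hg _⟩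
      ⟨_, homogeneousComponent_isHomogeneous d a, rfl⟩
  · rintro _ ⟨a, ha, rfl⟩
    exact ⟨hq.mul ha, Ideal.mem_sup_right
      (Ideal.mul_mem_right _ _ (Ideal.mem_span_singleton_self q))⟩

theorem degComp_inf_map_mulLeft (hq : q.IsHomogeneous m) (hreg : ∀ a, q * a ∈ J → a ∈ J) (d : ℕ) :
    degComp J (m + d) ⊓ (homogeneousSubmodule σ K d).map (LinearMap.mulLeft K q) =
      (degComp J d).map (LinearMap.mulLeft K q) := by
  apply le_antisymm
  · rintro _ ⟨⟨-, hqa⟩, a, ha, rfl⟩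
    exact ⟨a, ⟨ha, hreg a hqa⟩, rfl⟩
  · rintro _ ⟨a, ha, rfl⟩
    exact ⟨⟨hq.mul ha.1, J.mul_mem_left _ ha.2⟩, a, ha.1, rfl⟩

theorem degComp_span_range {ι : Type*} [Finite ι] {p : ι → MvPolynomial σ K}
    (hp : ∀ r, (p r).IsHomogeneous m) :
    degComp (Ideal.span (Set.range p)) m = Submodule.span K (Set.range p) := by
  have := Fintype.ofFinite ι
  apply le_antisymm
  · rintro f ⟨hf, hfp⟩
    obtain ⟨c, rfl⟩ := Ideal.mem_span_range_iff_exists_fun.1 hfp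
    have hcomp (r : ι) : homogeneousComponent m (c r * p r) = coeff 0 (c r) • p r := by
      simpa [mul_comm, smul_eq_C_mul] using homogeneousComponent_add_mul (hp r) (c r) 0
    rw [← homogeneousComponent_eq_self hf, map_sum]
    simp only [hcomp]
    exact sum_mem fun r _ ↦ Submodule.smul_mem _ _ (Submodule.subset_span ⟨r, rfl⟩)
  · rw [Submodule.span_le]
    rintro _ ⟨r, rfl⟩
    exact ⟨hp r, Ideal.subset_span ⟨r, rfl⟩⟩

end CommRing

variable [Field K] [Finite σ] {q : MvPolynomial σ K} {J : Ideal (MvPolynomial σ K)}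

instance finite_homogeneousSubmodule (d : ℕ) : Module.Finite K (homogeneousSubmodule σ K d) :=
  Module.Finite.iff_fg.2 (homogeneousSubmodule_fg _ _ d)

instance finite_degComp (J : Ideal (MvPolynomial σ K)) (d : ℕ) : Module.Finite K (degComp J d) :=
  Submodule.finiteDimensional_of_le inf_le_left

theorem finrank_degComp_sup_span_singleton (hJ : J.IsHomogeneous (homogeneousSubmodule σ K))
    (hq : q.IsHomogeneous m) (hreg : ∀ a, q * a ∈ J → a ∈ J) (d : ℕ) :
    Module.finrank K (degComp (J ⊔ Ideal.span {q}) (m + d)) + Module.finrank K (degComp J d) =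
      Module.finrank K (degComp J (m + d)) + Module.finrank K (homogeneousSubmodule σ K d) := by
  rcases eq_or_ne q 0 with rfl | hq0
  · obtain rfl : J = ⊤ := (Ideal.eq_top_iff_one J).2 (hreg 1 (by simp))
    have degComp_top (k : ℕ) :
        degComp (⊤ : Ideal (MvPolynomial σ K)) k = homogeneousSubmodule σ K k :=
      degComp_eq_homogeneousSubmodule_iff.2 fun _ _ ↦ trivial
    rw [top_sup_eq, degComp_top, degComp_top]
  · have hinj : Function.Injective (LinearMap.mulLeft K q) := mul_right_injective₀ hq0
    have := Submodule.finrank_sup_add_finrank_inf_eq (degComp J (m + d))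
      ((homogeneousSubmodule σ K d).map (LinearMap.mulLeft K q))
    rwa [← degComp_sup_span_singleton_add hJ hq, degComp_inf_map_mulLeft hq hreg,
      ← (Submodule.equivMapOfInjective _ hinj _).finrank_eq,
      ← (Submodule.equivMapOfInjective _ hinj _).finrank_eq] at this

theorem finrank_degComp_ofList_eq {rs ss : List (MvPolynomial σ K)}
    (hlen : rs.length = ss.length)
    (hrs : ∀ r ∈ rs, r.IsHomogeneous m) (hss : ∀ s ∈ ss, s.IsHomogeneous m)
    (hrs_reg : IsWeaklyRegular (MvPolynomial σ K) rs)
    (hss_reg : IsWeaklyRegular (MvPolynomial σ K) ss) (d : ℕ) :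
    Module.finrank K (degComp (Ideal.ofList rs) d) =
      Module.finrank K (degComp (Ideal.ofList ss) d) := by
  induction rs using List.reverseRecOn generalizing ss d with
  | nil => rw [List.length_eq_zero_iff.1 hlen.symm]
  | append_singleton rs r ih =>
    obtain rfl | ⟨ss, s, rfl⟩ := ss.eq_nil_or_concat'
    · simp at hlen
    simp only [List.forall_mem_append, List.forall_mem_singleton] at hrs hss
    rw [isWeaklyRegular_append_singleton_iff] at hrs_reg hss_reg
    replace ih := ih (by simpa using hlen) hrs.1 hss.1 hrs_reg.1 hss_reg.1
    have hr_hom : (Ideal.ofList rs).IsHomogeneous (homogeneousSubmodule σ K) :=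
      isHomogeneous_span hrs.1
    have hs_hom : (Ideal.ofList ss).IsHomogeneous (homogeneousSubmodule σ K) :=
      isHomogeneous_span hss.1
    rw [Ideal.ofList_append, Ideal.ofList_append, Ideal.ofList_singleton, Ideal.ofList_singleton]
    rcases lt_or_ge d m with hd | hd
    · rw [degComp_sup_span_singleton_of_lt hr_hom hrs.2 hd,
        degComp_sup_span_singleton_of_lt hs_hom hss.2 hd, ih]
    · obtain ⟨d, rfl⟩ := Nat.exists_eq_add_of_le hd
      have := finrank_degComp_sup_span_singleton hr_hom hrs.2 hrs_reg.2 d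
      have := finrank_degComp_sup_span_singleton hs_hom hss.2 hss_reg.2 d
      have := ih d
      have := ih (m + d)
      lia

end HilbertFunction

section SystemsOfParameters

open MvPolynomial RingTheory.Sequence

attribute [local instance] MvPolynomial.gradedAlgebra

variable {σ K : Type*} [Field K] {m d : ℕ}

section Fintype

variable [Fintype σ]

theorem mem_span_range_X_pow_of_isHomogeneous {f : MvPolynomial σ K} (hf : f.IsHomogeneous d)
    (hd : Fintype.card σ * (m - 1) < d) :
    f ∈ Ideal.span (Set.range fun i ↦ (X i : MvPolynomial σ K) ^ m) := by
  rw [← Set.image_univ, mem_span_X_pow_image]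
  intro x hx
  by_contra! hlt
  have hsum : x.degree = d := by
    by_contra hne
    exact mem_support_iff.1 hx (hf.coeff_eq_zero hne)
  have := Finset.sum_le_card_nsmul Finset.univ x (m - 1) fun i _ ↦
    Nat.le_sub_one_of_lt (hlt i (Set.mem_univ i))
  rw [← Finsupp.degree_eq_sum, hsum, Finset.card_univ, smul_eq_mul] at this
  lia

theorem exists_isHomogeneous_notMem_span_range_X_pow (hm : m ≠ 0) :
    ∃ f : MvPolynomial σ K, f.IsHomogeneous (Fintype.card σ * (m - 1)) ∧
      f ∉ Ideal.span (Set.range fun i ↦ (X i : MvPolynomial σ K) ^ m) := by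
  let x : σ →₀ ℕ := Finsupp.equivFunOnFinite.symm fun _ ↦ m - 1
  refine ⟨monomial x 1, isHomogeneous_monomial _ (by simp [x, Finsupp.degree_eq_sum]), ?_⟩
  rw [← Set.image_univ, mem_span_X_pow_image]
  classical
  intro hmem
  obtain ⟨i, -, hi⟩ := hmem x (by
    rw [mem_support_iff, coeff_monomial, if_pos rfl]
    exact one_ne_zero)
  have hi : m ≤ m - 1 := hi
  lia

theorem card_le_finrank_degComp_span_range_X_pow (hm : m ≠ 0) :
    Fintype.card σ ≤ Module.finrank K
      (degComp (Ideal.span (Set.range fun i ↦ (X i : MvPolynomial σ K) ^ m)) m) := by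
  have hli : LinearIndependent K fun i ↦ (X i : MvPolynomial σ K) ^ m := by
    have := (basisMonomials σ K).linearIndependent.comp _ (Finsupp.single_left_injective hm)
    simpa [Function.comp_def, X_pow_eq_monomial] using this
  rw [degComp_span_range fun i ↦ isHomogeneous_X_pow i m]
  exact linearIndependent_iff_card_le_finrank_span.1 hli

theorem finrank_degComp_ofList_of_isWeaklyRegular {rs : List (MvPolynomial σ K)}
    (hlen : rs.length = Fintype.card σ) (hrs : ∀ r ∈ rs, r.IsHomogeneous m)
    (hreg : IsWeaklyRegular (MvPolynomial σ K) rs) (d : ℕ) :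
    Module.finrank K (degComp (Ideal.ofList rs) d) =
      Module.finrank K
        (degComp (Ideal.span (Set.range fun i ↦ (X i : MvPolynomial σ K) ^ m)) d) := by
  rw [finrank_degComp_ofList_eq (ss := Finset.univ.toList.map fun i ↦ X i ^ m) (by simpa) hrs
    (by simp [isHomogeneous_X_pow]) hreg (isWeaklyRegular_map_X_pow (Finset.nodup_toList _) m) d,
    ofList_map_X_pow_univ]

end Fintype

variable [Infinite K] {p : σ → MvPolynomial σ K} {N : ℕ}

theorem exists_isWeaklyRegular_ofList_eq_span_range [Fintype σ] (hm : m ≠ 0)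
    (hp : ∀ r, (p r).IsHomogeneous m)
    (hN : idealOfVars σ K ^ N ≤ Ideal.span (Set.range p)) :
    ∃ rs : List (MvPolynomial σ K), rs.length = Fintype.card σ ∧ (∀ r ∈ rs, r.IsHomogeneous m) ∧
      IsWeaklyRegular (MvPolynomial σ K) rs ∧ Ideal.ofList rs = Ideal.span (Set.range p) := by
  set V : Submodule K (MvPolynomial σ K) := Submodule.span K (Set.range p) with hV
  have hPV : Ideal.span (V : Set (MvPolynomial σ K)) = Ideal.span (Set.range p) :=
    Submodule.span_span_of_tower K _ _
  obtain ⟨rs, hlen, hrsV, hreg⟩ := exists_isWeaklyRegular_of_pow_idealOfVars_le (hPV.symm ▸ hN)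
  have hrs : ∀ r ∈ rs, r.IsHomogeneous m := fun r hr ↦ by
    have := hrsV r hr
    rw [hV, ← degComp_span_range hp] at this
    exact this.1
  have hle : Ideal.ofList rs ≤ Ideal.span (Set.range p) :=
    Ideal.span_le.2 fun r hr ↦ hPV ▸ Ideal.subset_span (hrsV r hr)
  refine ⟨rs, hlen, hrs, hreg, le_antisymm hle ?_⟩
  have hdim : Module.finrank K V ≤ Module.finrank K (degComp (Ideal.ofList rs) m) := by
    rw [finrank_degComp_ofList_of_isWeaklyRegular hlen hrs hreg]
    exact (finrank_range_le_card p).trans (card_le_finrank_degComp_span_range_X_pow hm)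
  have : Module.Finite K V := .span_of_finite K (Set.finite_range p)
  have heq : degComp (Ideal.ofList rs) m = V :=
    Submodule.eq_of_le_of_finrank_le (hV ▸ degComp_span_range hp ▸ degComp_mono hle m) hdim
  rw [Ideal.span_le, Set.range_subset_iff]
  exact fun r ↦ (heq.ge (Submodule.subset_span ⟨r, rfl⟩) : p r ∈ degComp (Ideal.ofList rs) m).2

theorem finrank_degComp_span_range [Finite σ] (hm : m ≠ 0) (hp : ∀ r, (p r).IsHomogeneous m)
    (hN : idealOfVars σ K ^ N ≤ Ideal.span (Set.range p)) (d : ℕ) :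
    Module.finrank K (degComp (Ideal.span (Set.range p)) d) =
      Module.finrank K
        (degComp (Ideal.span (Set.range fun i ↦ (X i : MvPolynomial σ K) ^ m)) d) := by
  have := Fintype.ofFinite σ
  obtain ⟨rs, hlen, hrs, hreg, heq⟩ := exists_isWeaklyRegular_ofList_eq_span_range hm hp hN
  rw [← heq, finrank_degComp_ofList_of_isWeaklyRegular hlen hrs hreg]

theorem linearIndependent_of_pow_idealOfVars_le [Finite σ] (hm : m ≠ 0)
    (hp : ∀ r, (p r).IsHomogeneous m)
    (hN : idealOfVars σ K ^ N ≤ Ideal.span (Set.range p)) : LinearIndependent K p := by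
  have := Fintype.ofFinite σ
  rw [linearIndependent_iff_card_le_finrank_span, Set.finrank, ← degComp_span_range hp,
    finrank_degComp_span_range hm hp hN]
  exact card_le_finrank_degComp_span_range_X_pow hm

theorem mem_span_range_of_isHomogeneous [Fintype σ] (hm : m ≠ 0) (hp : ∀ r, (p r).IsHomogeneous m)
    (hN : idealOfVars σ K ^ N ≤ Ideal.span (Set.range p)) {f : MvPolynomial σ K}
    (hf : f.IsHomogeneous d) (hd : Fintype.card σ * (m - 1) < d) :
    f ∈ Ideal.span (Set.range p) := by
  have hdim := finrank_degComp_span_range hm hp hN d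
  rw [degComp_eq_homogeneousSubmodule_iff.2 fun f hf ↦
    mem_span_range_X_pow_of_isHomogeneous hf hd] at hdim
  exact degComp_eq_homogeneousSubmodule_iff.1
    (Submodule.eq_of_le_of_finrank_eq inf_le_left hdim) f hf

theorem exists_isHomogeneous_notMem_span_range [Fintype σ] (hm : m ≠ 0)
    (hp : ∀ r, (p r).IsHomogeneous m)
    (hN : idealOfVars σ K ^ N ≤ Ideal.span (Set.range p)) :
    ∃ f : MvPolynomial σ K, f.IsHomogeneous (Fintype.card σ * (m - 1)) ∧
      f ∉ Ideal.span (Set.range p) := by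
  by_contra! hmem
  have hdim := finrank_degComp_span_range hm hp hN (Fintype.card σ * (m - 1))
  rw [degComp_eq_homogeneousSubmodule_iff.2 hmem] at hdim
  obtain ⟨f, hf, hnot⟩ := exists_isHomogeneous_notMem_span_range_X_pow (σ := σ) (K := K) hm
  exact hnot (degComp_eq_homogeneousSubmodule_iff.1
    (Submodule.eq_of_le_of_finrank_eq inf_le_left hdim.symm) f hf)

end SystemsOfParameters

section PolynomialDensity

variable {R S F : Type*} [CommRing R] [CommRing S] [FunLike F R S] [RingHomClass F R S]
  (φ : F)

theorem exists_mem_sub_mem_mul_map (J : Ideal R) (K : Ideal S) (h : ∀ s, ∃ r, s - φ r ∈ K) {s : S}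
    (hs : s ∈ J.map φ) : ∃ r ∈ J, s - φ r ∈ K * J.map φ := by
  induction hs using Submodule.span_induction with
  | mem _ hx =>
    obtain ⟨r, hr, rfl⟩ := hx
    exact ⟨r, hr, by simp⟩
  | zero => exact ⟨0, zero_mem _, by simp⟩
  | add s t _ _ hs ht =>
    obtain ⟨a, ha, hsa⟩ := hs
    obtain ⟨b, hb, htb⟩ := ht
    exact ⟨a + b, add_mem ha hb, by simpa [add_sub_add_comm] using add_mem hsa htb⟩
  | smul t s _ hs =>
    obtain ⟨a, ha, hsa⟩ := hs
    obtain ⟨b, hb⟩ := h t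
    refine ⟨b * a, Ideal.mul_mem_left _ _ ha, ?_⟩
    have hsplit : t • s - φ (b * a) = t * (s - φ a) + (t - φ b) * φ a := by
      rw [map_mul, smul_eq_mul]
      ring
    exact hsplit ▸ add_mem (Ideal.mul_mem_left _ t hsa)
      (Ideal.mul_mem_mul hb (Ideal.mem_map_of_mem φ ha))

theorem exists_sub_mem_map_pow (I : Ideal R) (h : ∀ s, ∃ r, s - φ r ∈ I.map φ) (k : ℕ) (s : S) :
    ∃ r, s - φ r ∈ I.map φ ^ k := by
  induction k with
  | zero => exact ⟨0, by simp⟩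
  | succ k ih =>
    obtain ⟨a, ha⟩ := ih
    rw [← Ideal.map_pow] at ha
    obtain ⟨b, -, hb⟩ := exists_mem_sub_mem_mul_map φ (I ^ k) (I.map φ) h ha
    refine ⟨a + b, ?_⟩
    rwa [map_add, ← sub_sub, pow_succ', ← Ideal.map_pow]

end PolynomialDensity

section VanishingOrder

open MvPolynomial Asymptotics

theorem eval_smul_of_isHomogeneous {σ K : Type*} [CommSemiring K] {f : MvPolynomial σ K} {d : ℕ}
    (hf : f.IsHomogeneous d) (t : K) (z : σ → K) : eval (t • z) f = t ^ d * eval z f := by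
  rw [eval_eq, eval_eq, Finset.mul_sum]
  refine Finset.sum_congr rfl fun x hx ↦ ?_
  have hdeg : ∑ i ∈ x.support, x i = d := (hf.degree_eq_sum_deg_support hx).symm
  simp only [Pi.smul_apply, smul_eq_mul, mul_pow, Finset.prod_mul_distrib,
    Finset.prod_pow_eq_pow_sum, hdeg]
  ring

variable {𝕜 σ : Type*} [NontriviallyNormedField 𝕜] [Fintype σ]

theorem isBigO_eval_of_mem_pow_idealOfVars {f : MvPolynomial σ 𝕜} {k : ℕ}
    (hf : f ∈ idealOfVars σ 𝕜 ^ k) :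
    (fun z ↦ eval z f) =O[𝓝 0] fun z : σ → 𝕜 ↦ ‖z‖ ^ k := by
  induction k generalizing f with
  | zero => simpa using ((MvPolynomial.continuous_eval f).tendsto 0).isBigO_one ℝ
  | succ k ih =>
    rw [pow_succ] at hf
    induction hf using Submodule.mul_induction_on' with
    | mem_mul_mem g hg h hh =>
      simp only [map_mul, pow_succ]
      refine (ih hg).mul ?_
      induction hh using Submodule.span_induction with
      | mem _ hx =>
        obtain ⟨i, rfl⟩ := hx
        simpa using IsBigO.of_norm_right (isBigO_of_le _ fun z ↦ by simpa using norm_le_pi_norm z i)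
      | zero => simpa using isBigO_zero _ _
      | add a b _ _ ha hb => simpa using ha.add hb
      | smul c a _ ha =>
        have := ((MvPolynomial.continuous_eval c).tendsto 0).isBigO_one ℝ
        simpa using this.mul ha
    | add a _ b _ ha hb => simpa using ha.add hb

theorem eq_zero_of_isHomogeneous_of_isBigO {f : MvPolynomial σ 𝕜} {d : ℕ}
    (hf : f.IsHomogeneous d)
    (hO : (fun z ↦ eval z f) =O[𝓝 0] fun z : σ → 𝕜 ↦ ‖z‖ ^ (d + 1)) : f = 0 := by
  refine hf.eq_zero_of_forall_eval_eq_zero fun z ↦ ?_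
  have hline : Filter.Tendsto (fun t : 𝕜 ↦ t • z) (𝓝 0) (𝓝 0) := by
    have : Continuous fun t : 𝕜 ↦ t • z := by fun_prop
    simpa using this.tendsto 0
  by_contra hz
  have hO_line : (fun t : 𝕜 ↦ t ^ d) =O[𝓝 0] fun t ↦ t ^ (d + 1) := by
    have := hO.comp_tendsto hline
    simp only [Function.comp_def, eval_smul_of_isHomogeneous hf, norm_smul, mul_pow,
      mul_comm _ (eval z f), mul_comm _ (‖z‖ ^ (d + 1)), isBigO_const_mul_left_iff hz,
      ← norm_pow _ (d + 1)] at this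
    exact this.of_const_mul_right.of_norm_right
  have : (fun t : 𝕜 ↦ t ^ d) =o[𝓝[≠] 0] fun t ↦ t ^ d :=
    (hO_line.trans_isLittleO (isLittleO_pow_pow d.lt_succ_self)).mono nhdsWithin_le_nhds
  refine isLittleO_irrefl ?_ this
  refine Filter.Eventually.frequently ?_
  filter_upwards [self_mem_nhdsWithin] with t ht
  exact pow_ne_zero _ ht

theorem mem_pow_idealOfVars_of_isBigO {f : MvPolynomial σ 𝕜} {k : ℕ}
    (hO : (fun z ↦ eval z f) =O[𝓝 0] fun z : σ → 𝕜 ↦ ‖z‖ ^ k) : f ∈ idealOfVars σ 𝕜 ^ k := by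
  induction k with
  | zero => simp
  | succ k ih =>
    have hk : f ∈ idealOfVars σ 𝕜 ^ k :=
      ih (hO.trans (isLittleO_norm_pow_norm_pow k.lt_succ_self).isBigO)
    have hlow : f - homogeneousComponent k f ∈ idealOfVars σ 𝕜 ^ (k + 1) := by
      rw [mem_pow_idealOfVars_iff'] at hk ⊢
      intro x hx
      rw [coeff_sub, coeff_homogeneousComponent]
      split_ifs with hxk
      · exact sub_self _
      · rw [hk x (by lia), sub_zero]
    have hcomp : homogeneousComponent k f = 0 := by
      refine eq_zero_of_isHomogeneous_of_isBigO (homogeneousComponent_isHomogeneous k f) ?_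
      simpa using hO.sub (isBigO_eval_of_mem_pow_idealOfVars hlow)
    rwa [hcomp, sub_zero] at hlow

end VanishingOrder

section Germs

open MvPolynomial Asymptotics

theorem unshift_shift_apply_zero {𝕜 E F : Type*} [NontriviallyNormedField 𝕜]
    [NormedAddCommGroup E] [NormedSpace 𝕜 E] [NormedAddCommGroup F] [NormedSpace 𝕜 F]
    (q : FormalMultilinearSeries 𝕜 E F) : q.shift.unshift (q 0 0) = q := by
  ext k v
  cases k with
  | zero =>
    rw [Subsingleton.elim v 0]
    rfl
  | succ k => simp [FormalMultilinearSeries.unshift, FormalMultilinearSeries.shift]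

theorem exists_analyticAt_eventually_eq_add {𝕜 E F : Type*} [NontriviallyNormedField 𝕜]
    [NormedAddCommGroup E] [NormedSpace 𝕜 E] [NormedAddCommGroup F] [NormedSpace 𝕜 F]
    [CompleteSpace F] {g : E → F} {x : E} (hg : AnalyticAt 𝕜 g x) :
    ∃ G : E → E →L[𝕜] F, AnalyticAt 𝕜 G x ∧ ∀ᶠ y in 𝓝 x, g y = g x + G y (y - x) := by
  obtain ⟨q, hq⟩ := hg
  have hrad : 0 < q.shift.radius := by
    rw [FormalMultilinearSeries.radius_shift]
    exact hq.radius_pos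
  have hS := (q.shift.hasFPowerSeriesOnBall hrad).comp_sub x
  rw [zero_add] at hS
  have hunshift := hS.unshift (z := q 0 0)
  rw [unshift_shift_apply_zero] at hunshift
  refine ⟨_, hS.analyticAt, ?_⟩
  have := (hq.sub hunshift.hasFPowerSeriesAt)
  rw [sub_self] at this
  filter_upwards [this.eventually_eq_zero] with y hy
  rw [Pi.sub_apply, sub_eq_zero] at hy
  rw [hy, ← hq.coeff_zero 0]

variable {n : ℕ}

/-- The homomorphism sending a polynomial to the function it defines. -/
noncomputable def polyFun (n : ℕ) : MvPolynomial (Fin n) ℂ →ₐ[ℂ] holoAtZero n where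
  toFun p := ⟨fun z ↦ eval z p, AnalyticOnNhd.eval_mvPolynomial p 0 (Set.mem_univ _)⟩
  map_one' := Subtype.ext (funext fun z ↦ by simp)
  map_mul' a b := Subtype.ext (funext fun z ↦ by simp)
  map_zero' := Subtype.ext (funext fun z ↦ by simp)
  map_add' a b := Subtype.ext (funext fun z ↦ by simp)
  commutes' c := Subtype.ext (funext fun z ↦ by simp [algebraMap_eq])

/-- The homomorphism sending a function to its germ at the origin. -/
noncomputable def germHom (n : ℕ) : holoAtZero n →ₐ[ℂ] HoloGerm n :=
  Ideal.Quotient.mkₐ ℂ (zeroGerms n)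

theorem germHom_surjective : Function.Surjective (germHom n) :=
  Ideal.Quotient.mk_surjective

theorem ker_germHom : RingHom.ker (germHom n) = zeroGerms n :=
  Ideal.mk_ker

/-- The homomorphism sending a polynomial to its germ, that is, `polyGerm` as a homomorphism. -/
noncomputable def polyGermHom (n : ℕ) : MvPolynomial (Fin n) ℂ →ₐ[ℂ] HoloGerm n :=
  (germHom n).comp (polyFun n)

/-- The functions in `holoAtZero n` that vanish to order at least `k` at the origin. -/
def orderIdeal (n k : ℕ) : Ideal (holoAtZero n) where
  carrier := {g | g.1 =O[𝓝 0] fun z ↦ ‖z‖ ^ k}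
  zero_mem' := isBigO_zero _ _
  add_mem' ha hb := IsBigO.add ha hb
  smul_mem' c a ha := by
    change (fun z ↦ c.1 z * a.1 z) =O[𝓝 0] _
    simpa using (c.2.continuousAt.tendsto.isBigO_one ℝ).mul ha

theorem zeroGerms_le_orderIdeal (n k : ℕ) : zeroGerms n ≤ orderIdeal n k := fun _ hg ↦
  IsBigO.congr' (isBigO_zero _ _) (Filter.EventuallyEq.symm hg) .rfl

theorem mem_pow_idealOfVars_of_polyGermHom_mem {k : ℕ} {f : MvPolynomial (Fin n) ℂ}
    (hf : polyGermHom n f ∈ (idealOfVars (Fin n) ℂ).map (polyGermHom n) ^ k) :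
    f ∈ idealOfVars (Fin n) ℂ ^ k := by
  have hle : (idealOfVars (Fin n) ℂ ^ k).map (polyGermHom n) ≤ (orderIdeal n k).map (germHom n) :=
    Ideal.map_le_iff_le_comap.2 fun h hh ↦ Ideal.mem_map_of_mem (germHom n)
      (isBigO_eval_of_mem_pow_idealOfVars hh : polyFun n h ∈ orderIdeal n k)
  rw [← Ideal.map_pow] at hf
  replace hf := hle hf
  rw [Ideal.mem_map_iff_of_surjective _ germHom_surjective] at hf
  obtain ⟨h, hh, hhf⟩ := hf
  have hdiff : polyFun n f - h ∈ zeroGerms n := by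
    rw [← ker_germHom, RingHom.mem_ker, map_sub, hhf]
    exact sub_self _
  have hsum := add_mem (zeroGerms_le_orderIdeal n k hdiff) hh
  rw [sub_add_cancel] at hsum
  exact mem_pow_idealOfVars_of_isBigO hsum

theorem exists_sub_polyGermHom_mem_map_idealOfVars (g : HoloGerm n) :
    ∃ f, g - polyGermHom n f ∈ (idealOfVars (Fin n) ℂ).map (polyGermHom n) := by
  obtain ⟨g, rfl⟩ := germHom_surjective g
  obtain ⟨G, hG, hgG⟩ := exists_analyticAt_eventually_eq_add g.2
  let G' (i : Fin n) : holoAtZero n :=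
    ⟨fun z ↦ G z (Pi.single i 1),
      ((ContinuousLinearMap.apply ℂ ℂ (Pi.single i 1 : Fin n → ℂ)).analyticAt (G 0)).comp
        hG⟩
  have hzero : g - polyFun n (C (g.1 0)) - ∑ i, polyFun n (X i) * G' i ∈ zeroGerms n := by
    filter_upwards [hgG] with z hz
    have hlin : G z z = ∑ i, z i * G z (Pi.single i 1) := by
      simpa only [map_sum, map_smul, smul_eq_mul] using congrArg (G z) (pi_eq_sum_univ' z)
    have : (g - polyFun n (C (g.1 0)) - ∑ i, polyFun n (X i) * G' i).1 z =
        g.1 z - g.1 0 - ∑ i, z i * G z (Pi.single i 1) := by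
      simp [G', polyFun, Finset.sum_apply]
    rw [this, hz, sub_zero, hlin, add_sub_cancel_left, sub_self]
  rw [← ker_germHom, RingHom.mem_ker, map_sub, map_sub, sub_eq_zero, map_sum] at hzero
  refine ⟨C (g.1 0), hzero ▸ sum_mem fun i _ ↦ ?_⟩
  rw [map_mul]
  exact Ideal.mul_mem_right _ _ (Ideal.mem_map_of_mem (polyGermHom n) (Ideal.subset_span ⟨i, rfl⟩))

theorem exists_sub_polyGermHom_mem_map_pow (k : ℕ) (g : HoloGerm n) :
    ∃ f, g - polyGermHom n f ∈ (idealOfVars (Fin n) ℂ).map (polyGermHom n) ^ k :=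
  exists_sub_mem_map_pow (polyGermHom n) _ exists_sub_polyGermHom_mem_map_idealOfVars k g

variable {p : Fin n → MvPolynomial (Fin n) ℂ}

theorem map_span_range_eq_germIdeal (p : Fin n → MvPolynomial (Fin n) ℂ) :
    (Ideal.span (Set.range p)).map (polyGermHom n) = germIdeal p := by
  rw [Ideal.map_span, ← Set.range_comp]
  rfl

/-- The homomorphism sending a polynomial to the class of its germ in `𝒪ₙ / (p₁, …, pₙ)`. -/
noncomputable def toGermAlg (p : Fin n → MvPolynomial (Fin n) ℂ) :
    MvPolynomial (Fin n) ℂ →ₐ[ℂ] GermAlg p :=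
  (Ideal.Quotient.mkₐ ℂ (germIdeal p)).comp (polyGermHom n)

theorem mem_ker_toGermAlg {f : MvPolynomial (Fin n) ℂ} :
    f ∈ RingHom.ker (toGermAlg p) ↔ polyGermHom n f ∈ germIdeal p :=
  Ideal.Quotient.eq_zero_iff_mem

theorem mem_sup_pow_idealOfVars_of_mem_ker_toGermAlg {f : MvPolynomial (Fin n) ℂ}
    (hf : f ∈ RingHom.ker (toGermAlg p)) (k : ℕ) :
    f ∈ Ideal.span (Set.range p) ⊔ idealOfVars (Fin n) ℂ ^ k := by
  rw [mem_ker_toGermAlg, ← map_span_range_eq_germIdeal] at hf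
  obtain ⟨g, hg, hfg⟩ :=
    exists_mem_sub_mem_mul_map (polyGermHom n) _ _ (exists_sub_polyGermHom_mem_map_pow k) hf
  rw [← map_sub] at hfg
  have hrem : f - g ∈ idealOfVars (Fin n) ℂ ^ k :=
    mem_pow_idealOfVars_of_polyGermHom_mem (Ideal.mul_le_left hfg)
  rw [← add_sub_cancel g f]
  exact Submodule.add_mem_sup hg hrem

variable {m : ℕ}

theorem ker_toGermAlg (hp : ∀ r, (p r).IsHomogeneous m) :
    RingHom.ker (toGermAlg p) = Ideal.span (Set.range p) := by
  apply le_antisymm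
  · intro f hf
    exact mem_of_mem_sup_pow_idealOfVars (isHomogeneous_span (Set.forall_mem_range.2 hp))
      (mem_sup_pow_idealOfVars_of_mem_ker_toGermAlg hf _) f.totalDegree.lt_succ_self
  · rw [Ideal.span_le, Set.range_subset_iff]
    exact fun r ↦ mem_ker_toGermAlg.2 (Ideal.subset_span ⟨r, rfl⟩)

variable [Module.Finite ℂ (GermAlg p)]

theorem X_pow_mem_span_range (hp : ∀ r, (p r).IsHomogeneous m) (i : Fin n) :
    ∃ k, (X i : MvPolynomial (Fin n) ℂ) ^ k ∈ Ideal.span (Set.range p) := by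
  obtain ⟨g, hg, hg0⟩ := Algebra.IsIntegral.isIntegral (R := ℂ) (toGermAlg p (X i))
  refine ⟨g.natDegree, ?_⟩
  have hmem : Polynomial.aeval (X i : MvPolynomial (Fin n) ℂ) g ∈ Ideal.span (Set.range p) := by
    rwa [← ker_toGermAlg hp, RingHom.mem_ker, ← Polynomial.aeval_algHom_apply]
  have htop : homogeneousComponent g.natDegree (Polynomial.aeval (X i) g) =
      (X i : MvPolynomial (Fin n) ℂ) ^ g.natDegree := by
    rw [Polynomial.aeval_eq_sum_range, map_sum, Finset.sum_eq_single g.natDegree]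
    · rw [hg.coeff_natDegree, one_smul, homogeneousComponent_eq_self (isHomogeneous_X_pow i _)]
    · intro j _ hj
      rw [map_smul, homogeneousComponent_of_mem (isHomogeneous_X_pow i j), if_neg hj.symm,
        smul_zero]
    · simp
  exact htop ▸ homogeneousComponent_mem_of_mem
    (isHomogeneous_span (Set.forall_mem_range.2 hp)) hmem g.natDegree

theorem exists_pow_idealOfVars_le (hp : ∀ r, (p r).IsHomogeneous m) :
    ∃ N, idealOfVars (Fin n) ℂ ^ N ≤ Ideal.span (Set.range p) := by
  refine Ideal.exists_pow_le_of_le_radical_of_fg ?_ (idealOfVars_fg _ _)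
  rw [Ideal.span_le, Set.range_subset_iff]
  exact X_pow_mem_span_range hp

theorem toGermAlg_surjective (hp : ∀ r, (p r).IsHomogeneous m) :
    Function.Surjective (toGermAlg p) := by
  intro b
  obtain ⟨g, rfl⟩ := Ideal.Quotient.mk_surjective b
  obtain ⟨N, hN⟩ := exists_pow_idealOfVars_le hp
  obtain ⟨f, hf⟩ := exists_sub_polyGermHom_mem_map_pow N g
  have hle : (idealOfVars (Fin n) ℂ).map (polyGermHom n) ^ N ≤ germIdeal p := by
    rw [← Ideal.map_pow, ← map_span_range_eq_germIdeal]
    exact Ideal.map_mono hN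
  exact ⟨f, (Ideal.Quotient.eq.2 (hle hf)).symm⟩

theorem exists_surjective_algHom_ker_eq_span_range (hp : ∀ r, (p r).IsHomogeneous m)
    {A : Type*} [CommRing A] [Algebra ℂ A] (e : A ≃ₐ[ℂ] GermAlg p) :
    ∃ φ : MvPolynomial (Fin n) ℂ →ₐ[ℂ] A, Function.Surjective φ ∧
      RingHom.ker φ = Ideal.span (Set.range p) := by
  refine ⟨e.symm.toAlgHom.comp (toGermAlg p), e.symm.surjective.comp (toGermAlg_surjective hp), ?_⟩
  rw [← ker_toGermAlg hp]
  exact Ideal.ext fun _ ↦ e.symm.map_eq_zero_iff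

end Germs

section Congruence

variable {B : Type*} [CommRing B]

theorem mul_sub_mul_mem {I : Ideal B} {k l : ℕ} {a b a' b' : B} (hb : b ∈ I ^ k)
    (hab : a - b ∈ I ^ (k + 1)) (ha' : a' ∈ I ^ l) (hab' : a' - b' ∈ I ^ (l + 1)) :
    a * a' - b * b' ∈ I ^ (k + l + 1) := by
  have hsplit : a * a' - b * b' = (a - b) * a' + b * (a' - b') := by ring
  rw [hsplit]
  refine Ideal.add_mem _ ?_ ?_
  · rw [add_right_comm, pow_add]
    exact Ideal.mul_mem_mul hab ha'
  · rw [add_assoc, pow_add]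
    exact Ideal.mul_mem_mul hb hab'

theorem pow_sub_pow_mem {I : Ideal B} {a b : B} (ha : a ∈ I) (hb : b ∈ I) (hab : a - b ∈ I ^ 2)
    (k : ℕ) : a ^ k - b ^ k ∈ I ^ (k + 1) := by
  induction k with
  | zero => simp
  | succ k ih =>
    rw [pow_succ a, pow_succ b]
    exact mul_sub_mul_mem (l := 1) (Ideal.pow_mem_pow hb k) ih (by rwa [pow_one]) hab

theorem prod_pow_sub_prod_pow_mem {ι : Type*} {I : Ideal B} {a b : ι → B} (ha : ∀ i, a i ∈ I)
    (hb : ∀ i, b i ∈ I) (hab : ∀ i, a i - b i ∈ I ^ 2) (k : ι → ℕ) (s : Finset ι) :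
    ∏ i ∈ s, a i ^ k i - ∏ i ∈ s, b i ^ k i ∈ I ^ (∑ i ∈ s, k i + 1) := by
  classical
  induction s using Finset.induction_on with
  | empty => simp
  | insert i s hi ih =>
    rw [Finset.prod_insert hi, Finset.prod_insert hi, Finset.sum_insert hi]
    refine mul_sub_mul_mem (Ideal.pow_mem_pow (hb i) _)
      (pow_sub_pow_mem (ha i) (hb i) (hab i) _) ?_ ih
    rw [← Finset.prod_pow_eq_pow_sum]
    exact Ideal.prod_mem_prod fun j _ ↦ Ideal.pow_mem_pow (ha j) _

theorem aeval_sub_aeval_mem_of_isHomogeneous {σ R : Type*} [CommRing R] [Algebra R B] {I : Ideal B}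
    {f : MvPolynomial σ R} {m : ℕ} (hf : f.IsHomogeneous m) {a b : σ → B} (ha : ∀ i, a i ∈ I)
    (hb : ∀ i, b i ∈ I) (hab : ∀ i, a i - b i ∈ I ^ 2) :
    MvPolynomial.aeval a f - MvPolynomial.aeval b f ∈ I ^ (m + 1) := by
  rw [MvPolynomial.aeval_def, MvPolynomial.aeval_def, MvPolynomial.eval₂_eq,
    MvPolynomial.eval₂_eq, ← Finset.sum_sub_distrib]
  refine Ideal.sum_mem _ fun d hd ↦ ?_
  rw [← mul_sub, hf.degree_eq_sum_deg_support hd]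
  exact Ideal.mul_mem_left _ _ (prod_pow_sub_prod_pow_mem ha hb hab d d.support)

theorem map_mem_map_pow_iff {R F : Type*} [CommRing R] [FunLike F R B] [RingHomClass F R B] {φ : F}
    (hφ : Function.Surjective φ) (I : Ideal R) {f : R} {k : ℕ} :
    φ f ∈ I.map φ ^ k ↔ f ∈ RingHom.ker φ ⊔ I ^ k := by
  rw [← Ideal.map_pow, ← Ideal.mem_comap, Ideal.comap_map_of_surjective' φ hφ, sup_comm]

end Congruence

section LinearForms

open MvPolynomial

variable {σ R : Type*} [Fintype σ] [CommRing R] {m : ℕ}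

/-- The linear form with a given coefficient vector, depending linearly on the latter. -/
noncomputable def linForm (σ R : Type*) [Fintype σ] [CommRing R] :
    (σ → R) →ₗ[R] MvPolynomial σ R :=
  Fintype.linearCombination R X

theorem toMvPolynomial_eq_linForm (c : Matrix σ σ R) (i : σ) :
    c.toMvPolynomial i = linForm σ R (c i) := by
  simp [Matrix.toMvPolynomial, linForm, Fintype.linearCombination_apply, X, smul_monomial]

theorem isHomogeneous_linForm (v : σ → R) : (linForm σ R v).IsHomogeneous 1 :=
  IsHomogeneous.sum _ _ _ fun i _ ↦ by
    rw [smul_eq_C_mul]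
    exact isHomogeneous_C_mul_X _ _

theorem linForm_mem_idealOfVars (v : σ → R) : linForm σ R v ∈ idealOfVars σ R := by
  simpa only [pow_one] using mem_pow_idealOfVars_of_isHomogeneous (isHomogeneous_linForm v)

theorem eq_zero_of_linForm_mem_sq {v : σ → R} (h : linForm σ R v ∈ idealOfVars σ R ^ 2) :
    v = 0 := by
  classical
  funext i
  have hcoeff : coeff (Finsupp.single i 1) (linForm σ R v) = v i := by
    simp [linForm, Fintype.linearCombination_apply, coeff_sum, coeff_X, Finsupp.single_left_inj]
  rw [← hcoeff]
  exact (mem_pow_idealOfVars_iff' _ _).1 h _ (by simp)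

theorem exists_sub_linForm_mem_sq {f : MvPolynomial σ R} (hf : f ∈ idealOfVars σ R) :
    ∃ v, f - linForm σ R v ∈ idealOfVars σ R ^ 2 := by
  have hlin := homogeneousComponent_mem 1 f
  rw [homogeneousSubmodule_one_eq_span_X, Submodule.mem_span_range_iff_exists_fun] at hlin
  obtain ⟨v, hv⟩ := hlin
  refine ⟨v, ?_⟩
  rw [linForm, Fintype.linearCombination_apply, hv, mem_pow_idealOfVars_iff']
  intro x hx
  rw [coeff_sub, coeff_homogeneousComponent]
  split_ifs with hdeg
  · exact sub_self _
  · obtain rfl : x = 0 := by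
      rw [← Finsupp.degree_eq_zero_iff]
      lia
    rw [mem_idealOfVars_iff, constantCoeff_eq] at hf
    rw [hf, sub_zero]

theorem leftInverse_bind₁_toMvPolynomial [DecidableEq σ] {M N : Matrix σ σ R} (h : M * N = 1) :
    Function.LeftInverse (bind₁ N.toMvPolynomial) (bind₁ M.toMvPolynomial) := fun f ↦ by
  simp only [bind₁_bind₁, ← Matrix.toMvPolynomial_mul, h, Matrix.toMvPolynomial_one]
  exact aeval_X_left_apply f

theorem isHomogeneous_bind₁_toMvPolynomial (c : Matrix σ σ R) {f : MvPolynomial σ R}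
    (hf : f.IsHomogeneous m) : (bind₁ c.toMvPolynomial f).IsHomogeneous m := by
  have := hf.aeval _ c.toMvPolynomial_isHomogeneous
  rwa [one_mul] at this

theorem eval_bind₁_toMvPolynomial (c : Matrix σ σ R) (f : MvPolynomial σ R) (z : σ → R) :
    eval z (bind₁ c.toMvPolynomial f) = eval (c.mulVec z) f := by
  rw [← aeval_eq_eval, aeval_bind₁]
  simp only [aeval_eq_eval, Matrix.toMvPolynomial_eval_eq_apply]

end LinearForms

section Forms

open MvPolynomial

variable {n m : ℕ} {R : Type*} [CommRing R]

/-- The form of degree `m` with a given vector of coefficients at the monomials `q_ρ`, depending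
linearly on the latter. -/
noncomputable def coeffForm (n m : ℕ) (R : Type*) [CommRing R] :
    (MonoIdx n m → R) →ₗ[R] MvPolynomial (Fin n) R :=
  Fintype.linearCombination R fun ρ ↦ mono ρ X

theorem mono_X_eq_monomial (ρ : MonoIdx n m) :
    mono ρ (X : Fin n → MvPolynomial (Fin n) R) =
      monomial (Finsupp.equivFunOnFinite.symm ρ.1) 1 := by
  rw [monomial_eq, map_one, one_mul, Finsupp.prod_fintype _ _ (by simp)]
  rfl

theorem isHomogeneous_coeffForm (γ : MonoIdx n m → R) : (coeffForm n m R γ).IsHomogeneous m := by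
  rw [coeffForm, Fintype.linearCombination_apply]
  refine IsHomogeneous.sum _ _ _ fun ρ _ ↦ ?_
  rw [mono_X_eq_monomial, smul_monomial]
  refine isHomogeneous_monomial _ ?_
  rw [Finsupp.degree_eq_sum]
  exact (Finset.mem_piAntidiag.1 ρ.2).1

theorem coeffForm_injective : Function.Injective (coeffForm n m R) := by
  have := (basisMonomials (Fin n) R).linearIndependent.comp
    (fun ρ : MonoIdx n m ↦ Finsupp.equivFunOnFinite.symm ρ.1)
    (Finsupp.equivFunOnFinite.symm.injective.comp Subtype.val_injective)
  simp only [Function.comp_def, coe_basisMonomials, ← mono_X_eq_monomial] at this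
  exact this.fintypeLinearCombination_injective

theorem exists_coeffForm_eq {f : MvPolynomial (Fin n) R} (hf : f.IsHomogeneous m) :
    ∃ γ, coeffForm n m R γ = f := by
  suffices f ∈ Submodule.span R (Set.range fun ρ : MonoIdx n m ↦ mono ρ X) from
    (Submodule.mem_span_range_iff_exists_fun R).1 this
  rw [f.as_sum]
  refine Submodule.sum_mem _ fun d hd ↦ ?_
  have hdeg : ∑ i, d i = m := by
    rw [← Finsupp.degree_eq_sum]
    by_contra h
    exact mem_support_iff.1 hd (hf.coeff_eq_zero h)
  let ρ : MonoIdx n m := ⟨d, Finset.mem_piAntidiag.2 ⟨hdeg, by simp⟩⟩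
  have hmono : monomial d (coeff d f) = coeff d f • mono ρ X := by
    rw [mono_X_eq_monomial, smul_monomial, smul_eq_mul, mul_one]
    simp [ρ]
  exact hmono ▸ Submodule.smul_mem _ _ (Submodule.subset_span ⟨ρ, rfl⟩)

theorem aeval_coeffForm {B : Type*} [CommRing B] [Algebra R B] (γ : MonoIdx n m → R)
    (x : Fin n → B) : aeval x (coeffForm n m R γ) = ∑ ρ, γ ρ • mono ρ x := by
  simp [coeffForm, Fintype.linearCombination_apply, mono]

theorem eval_coeffForm (Γ : Matrix (Fin n) (MonoIdx n m) ℂ) (z : Fin n → ℂ) (r : Fin n) :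
    eval z (coeffForm n m ℂ (Γ r)) = recMap Γ z r := by
  rw [← coe_aeval_eq_eval]
  exact aeval_coeffForm _ _

end Forms

section GradedQuotient

open MvPolynomial

attribute [local instance] MvPolynomial.gradedAlgebra

variable {σ K A : Type*} [Field K] [CommRing A] [Algebra K A] {φ : MvPolynomial σ K →ₐ[K] A}
  {m N : ℕ}

theorem eq_map_idealOfVars_of_isMaximal (hφ : Function.Surjective φ)
    (hN : idealOfVars σ K ^ N ≤ RingHom.ker φ) {𝔪 : Ideal A} (h𝔪 : 𝔪.IsMaximal) :
    𝔪 = (idealOfVars σ K).map φ := by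
  have hmax : (𝔪.comap φ).IsMaximal := Ideal.comap_isMaximal_of_surjective φ hφ
  have hle : idealOfVars σ K ≤ 𝔪.comap φ :=
    hmax.isPrime.le_of_pow_le (hN.trans (Ideal.comap_mono bot_le))
  rw [isMaximal_idealOfVars.eq_of_le hmax.ne_top hle, Ideal.map_comap_of_surjective φ hφ]

theorem isLocalRing_of_pow_idealOfVars_le_ker (hφ : Function.Surjective φ)
    (hN : idealOfVars σ K ^ N ≤ RingHom.ker φ) (hle : RingHom.ker φ ≤ idealOfVars σ K) :
    IsLocalRing A := by
  have : Nontrivial A := by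
    refine ⟨1, 0, fun h ↦ isMaximal_idealOfVars.ne_top ((Ideal.eq_top_iff_one _).2 (hle ?_))⟩
    rw [RingHom.mem_ker, map_one, h]
  obtain ⟨I, hI⟩ := Ideal.exists_maximal A
  exact IsLocalRing.of_unique_max_ideal ⟨I, hI, fun J hJ ↦ by
    rw [eq_map_idealOfVars_of_isMaximal hφ hN hI, eq_map_idealOfVars_of_isMaximal hφ hN hJ]⟩

theorem map_mem_map_pow_succ_iff {ι : Type*} [Finite ι] {p : ι → MvPolynomial σ K}
    (hp : ∀ r, (p r).IsHomogeneous m) (hφ : Function.Surjective φ)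
    (hker : RingHom.ker φ = Ideal.span (Set.range p)) {f : MvPolynomial σ K}
    (hf : f.IsHomogeneous m) :
    φ f ∈ (idealOfVars σ K).map φ ^ (m + 1) ↔ f ∈ Submodule.span K (Set.range p) := by
  rw [map_mem_map_pow_iff hφ, hker, ← degComp_span_range hp]
  exact ⟨fun h ↦ ⟨hf, mem_of_mem_sup_pow_idealOfVars
    (isHomogeneous_span (Set.forall_mem_range.2 hp)) h (Nat.lt_succ_of_le hf.totalDegree_le)⟩,
    fun h ↦ Ideal.mem_sup_left h.2⟩

variable [Fintype σ] {p : σ → MvPolynomial σ K}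

theorem isNilIndex_map_idealOfVars [Infinite K] (hm : m ≠ 0) (hp : ∀ r, (p r).IsHomogeneous m)
    (hker : RingHom.ker φ = Ideal.span (Set.range p))
    (hN : idealOfVars σ K ^ N ≤ Ideal.span (Set.range p)) :
    IsNilIndex ((idealOfVars σ K).map φ) (Fintype.card σ * (m - 1)) := by
  have hpow (k : ℕ) : (idealOfVars σ K).map φ ^ k = ⊥ ↔
      idealOfVars σ K ^ k ≤ Ideal.span (Set.range p) := by
    rw [← Ideal.map_pow, ← hker, Ideal.map_eq_bot_iff_le_ker]
  constructor
  · intro hbot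
    obtain ⟨f, hf, hnot⟩ := exists_isHomogeneous_notMem_span_range hm hp hN
    exact hnot ((hpow _).1 hbot (mem_pow_idealOfVars_of_isHomogeneous hf))
  · intro k hk
    by_contra! hlt
    apply hk
    rw [hpow, pow_idealOfVars_eq_span, Ideal.span_le]
    rintro _ ⟨x, hx, rfl⟩
    exact mem_span_range_of_isHomogeneous hm hp hN (isHomogeneous_monomial _ hx) hlt

/-- The class in `𝔪 / 𝔪²` of the image of a linear form, where `𝔪` is generated by the images of
the variables. It compares a cotangent space with the space of linear forms. -/
noncomputable def linFormCotangent (φ : MvPolynomial σ K →ₐ[K] A) :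
    (σ → K) →ₗ[K] ((idealOfVars σ K).map φ).Cotangent :=
  (((idealOfVars σ K).map φ).toCotangent.restrictScalars K).comp
    ((φ.toLinearMap ∘ₗ linForm σ K).codRestrict (((idealOfVars σ K).map φ).restrictScalars K)
      fun v ↦ Ideal.mem_map_of_mem φ (linForm_mem_idealOfVars v))

theorem linFormCotangent_eq_toCotangent_iff {v : σ → K} {x : (idealOfVars σ K).map φ} :
    linFormCotangent φ v = ((idealOfVars σ K).map φ).toCotangent x ↔
      (x : A) - φ (linForm σ K v) ∈ (idealOfVars σ K).map φ ^ 2 :=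
  eq_comm.trans (Ideal.toCotangent_eq _)

theorem linFormCotangent_bijective (hφ : Function.Surjective φ)
    (hle : RingHom.ker φ ≤ idealOfVars σ K ^ 2) : Function.Bijective (linFormCotangent φ) := by
  constructor
  · rw [injective_iff_map_eq_zero]
    intro v hv
    replace hv : φ (linForm σ K v) ∈ (idealOfVars σ K).map φ ^ 2 :=
      (Ideal.toCotangent_eq_zero _ _).1 hv
    rw [map_mem_map_pow_iff hφ, sup_eq_right.2 hle] at hv
    exact eq_zero_of_linForm_mem_sq hv
  · intro y
    obtain ⟨⟨x, hx⟩, rfl⟩ := Ideal.toCotangent_surjective _ y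
    obtain ⟨f, hf, rfl⟩ := (Ideal.mem_map_iff_of_surjective φ hφ).1 hx
    obtain ⟨v, hv⟩ := exists_sub_linForm_mem_sq hf
    refine ⟨v, linFormCotangent_eq_toCotangent_iff.2 ?_⟩
    rw [← map_sub, ← Ideal.map_pow]
    exact Ideal.mem_map_of_mem φ hv

theorem finrank_cotangent_map_idealOfVars (hφ : Function.Surjective φ)
    (hle : RingHom.ker φ ≤ idealOfVars σ K ^ 2) :
    Module.finrank K ((idealOfVars σ K).map φ).Cotangent = Fintype.card σ := by
  rw [← (LinearEquiv.ofBijective _ (linFormCotangent_bijective hφ hle)).finrank_eq,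
    Module.finrank_fintype_fun_eq_card]

end GradedQuotient

section Relations

open MvPolynomial

variable {A : Type*} [CommRing A] [Algebra ℂ A]

theorem linearIndependent_toCotangent {ι : Type*} {𝔪 : Ideal A} {E : Submodule ℂ 𝔪}
    (hE : Disjoint E (subspaceIn 𝔪 (𝔪 ^ 2))) {f : ι → E} (hf : LinearIndependent ℂ f) :
    LinearIndependent ℂ fun i ↦ 𝔪.toCotangent (f i) := by
  refine hf.map' ((𝔪.toCotangent.restrictScalars ℂ) ∘ₗ E.subtype) ?_
  refine LinearMap.ker_eq_bot'.2 fun x hx ↦ Subtype.ext ?_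
  exact Submodule.disjoint_def.1 hE x x.2 ((𝔪.toCotangent_eq_zero _).1 hx)

variable {n m : ℕ} {φ : MvPolynomial (Fin n) ℂ →ₐ[ℂ] A}

theorem exists_isUnit_sub_toMvPolynomial_mem (hφ : Function.Surjective φ)
    (hle : RingHom.ker φ ≤ idealOfVars (Fin n) ℂ ^ 2)
    {E : Submodule ℂ ((idealOfVars (Fin n) ℂ).map φ)}
    (hE : Disjoint E (subspaceIn _ ((idealOfVars (Fin n) ℂ).map φ ^ 2)))
    {f : Fin n → E} (hf : LinearIndependent ℂ f) :
    ∃ c : Matrix (Fin n) (Fin n) ℂ, IsUnit c ∧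
      ∀ i, ((f i : (idealOfVars (Fin n) ℂ).map φ) : A) - φ (c.toMvPolynomial i) ∈
        (idealOfVars (Fin n) ℂ).map φ ^ 2 := by
  let ℓ := LinearEquiv.ofBijective _ (linFormCotangent_bijective hφ hle)
  refine ⟨Matrix.of fun i ↦ ℓ.symm (Ideal.toCotangent _ (f i)), ?_, fun i ↦ ?_⟩
  · rw [← Matrix.linearIndependent_rows_iff_isUnit]
    exact (linearIndependent_toCotangent hE hf).map' ℓ.symm.toLinearMap ℓ.symm.ker
  · rw [toMvPolynomial_eq_linForm]
    exact linFormCotangent_eq_toCotangent_iff.1 (ℓ.apply_symm_apply _)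

theorem sum_smul_projectionOnto_monoIn_eq_zero_iff {𝔪 : Ideal A} {x : Fin n → 𝔪}
    {S : Submodule ℂ ↥(𝔪 ^ m)} (hS : IsCompl S (subspaceIn (𝔪 ^ m) (𝔪 ^ (m + 1))))
    (γ : MonoIdx n m → ℂ) :
    ∑ ρ, γ ρ • Submodule.projectionOnto S _ hS (monoIn 𝔪 ρ x) = 0 ↔
      aeval (fun i ↦ (x i : A)) (coeffForm n m ℂ γ) ∈ 𝔪 ^ (m + 1) := by
  simp only [← map_smul, ← map_sum]
  rw [Submodule.projectionOnto_apply_eq_zero_iff, aeval_coeffForm]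
  have hcoe : ((∑ ρ, γ ρ • monoIn 𝔪 ρ x : ↥(𝔪 ^ m)) : A) =
      ∑ ρ, γ ρ • mono ρ fun i ↦ (x i : A) := by
    simp [monoIn]
  exact hcoe ▸ Iff.rfl

variable {p : Fin n → MvPolynomial (Fin n) ℂ}

theorem sum_smul_projectionOnto_monoIn_eq_zero_iff_bind₁_mem_span
    (hp : ∀ r, (p r).IsHomogeneous m) (hφ : Function.Surjective φ)
    (hker : RingHom.ker φ = Ideal.span (Set.range p))
    {x : Fin n → (idealOfVars (Fin n) ℂ).map φ} {c : Matrix (Fin n) (Fin n) ℂ}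
    (hc : ∀ i, (x i : A) - φ (c.toMvPolynomial i) ∈ (idealOfVars (Fin n) ℂ).map φ ^ 2)
    {S : Submodule ℂ ↥((idealOfVars (Fin n) ℂ).map φ ^ m)}
    (hS : IsCompl S (subspaceIn _ ((idealOfVars (Fin n) ℂ).map φ ^ (m + 1))))
    (γ : MonoIdx n m → ℂ) :
    ∑ ρ, γ ρ • Submodule.projectionOnto S _ hS (monoIn _ ρ x) = 0 ↔
      bind₁ c.toMvPolynomial (coeffForm n m ℂ γ) ∈ Submodule.span ℂ (Set.range p) := by
  have hlin (i : Fin n) : φ (c.toMvPolynomial i) ∈ (idealOfVars (Fin n) ℂ).map φ := by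
    rw [toMvPolynomial_eq_linForm]
    exact Ideal.mem_map_of_mem φ (linForm_mem_idealOfVars _)
  have hcongr := aeval_sub_aeval_mem_of_isHomogeneous (isHomogeneous_coeffForm γ)
    (fun i ↦ (x i).2) hlin hc
  have hsubst : φ (bind₁ c.toMvPolynomial (coeffForm n m ℂ γ)) =
      aeval (fun i ↦ φ (c.toMvPolynomial i)) (coeffForm n m ℂ γ) := by
    rw [← aeval_eq_bind₁, comp_aeval_apply]
  rw [sum_smul_projectionOnto_monoIn_eq_zero_iff, ← map_mem_map_pow_succ_iff hp hφ hker
    (isHomogeneous_bind₁_toMvPolynomial c (isHomogeneous_coeffForm γ)), hsubst]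
  exact ⟨fun h ↦ (Submodule.sub_mem_iff_right _ h).1 hcongr,
    fun h ↦ (Submodule.sub_mem_iff_left _ h).1 hcongr⟩

end Relations

section Reconstruction

open MvPolynomial

variable {n m : ℕ}

theorem exists_linearIndependent_bind₁_coeffForm_eq {R : Type*} [CommRing R]
    {p : Fin n → MvPolynomial (Fin n) R} {c : Matrix (Fin n) (Fin n) R}
    (hp : ∀ r, (p r).IsHomogeneous m) (hli : LinearIndependent R p) (hc : IsUnit c) :
    ∃ Γ : Matrix (Fin n) (MonoIdx n m) R, LinearIndependent R Γ.row ∧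
      ∀ r, bind₁ c.toMvPolynomial (coeffForm n m R (Γ r)) = p r := by
  obtain ⟨c', hc'c⟩ := hc.exists_left_inv
  choose Γ hΓ using fun r ↦ exists_coeffForm_eq (isHomogeneous_bind₁_toMvPolynomial c' (hp r))
  have hΓp (r : Fin n) : bind₁ c.toMvPolynomial (coeffForm n m R (Γ r)) = p r := by
    rw [hΓ, leftInverse_bind₁_toMvPolynomial hc'c]
  refine ⟨Γ, .of_comp ((bind₁ c.toMvPolynomial).toLinearMap ∘ₗ coeffForm n m R) ?_, hΓp⟩
  obtain rfl : (fun r ↦ bind₁ c.toMvPolynomial (coeffForm n m R (Γ r))) = p := _root_.funext hΓp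
  exact hli

theorem isUnit_of_bind₁_coeffForm_eq {K : Type*} [Field K] {p : Fin n → MvPolynomial (Fin n) K}
    {c M : Matrix (Fin n) (Fin n) K} {Γ : Matrix (Fin n) (MonoIdx n m) K} (hc : IsUnit c)
    (hΓ : LinearIndependent K Γ.row)
    (hM : ∀ r, ∑ s, M r s • p s = bind₁ c.toMvPolynomial (coeffForm n m K (Γ r))) : IsUnit M := by
  obtain ⟨c', hcc'⟩ := hc.exists_right_inv
  rw [← Matrix.linearIndependent_rows_iff_isUnit]
  refine .of_comp (Fintype.linearCombination K p) ?_
  have hψ : Function.Injective ((bind₁ c.toMvPolynomial).toLinearMap ∘ₗ coeffForm n m K) :=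
    (leftInverse_bind₁_toMvPolynomial hcc').injective.comp coeffForm_injective
  have hcomp : Fintype.linearCombination K p ∘ M.row =
      ((bind₁ c.toMvPolynomial).toLinearMap ∘ₗ coeffForm n m K) ∘ Γ.row :=
    _root_.funext hM
  exact hcomp ▸ hΓ.map' _ (LinearMap.ker_eq_bot.2 hψ)

variable {p : Fin n → MvPolynomial (Fin n) ℂ} {c : Matrix (Fin n) (Fin n) ℂ}
  {Γ : Matrix (Fin n) (MonoIdx n m) ℂ}

theorem recMap_mulVec_of_bind₁_coeffForm_eq {M : Matrix (Fin n) (Fin n) ℂ}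
    (hM : ∀ r, ∑ s, M r s • p s = bind₁ c.toMvPolynomial (coeffForm n m ℂ (Γ r))) (z : Fin n → ℂ) :
    recMap Γ (c.mulVec z) = M.mulVec (polyMap p z) := by
  ext r
  rw [← eval_coeffForm, ← eval_bind₁_toMvPolynomial, ← hM r, map_sum]
  simp [Matrix.mulVec, dotProduct, polyMap, smul_eval]

theorem linearlyEquivalent_recMap_polyMap (hc : IsUnit c) (hΓ : LinearIndependent ℂ Γ.row)
    (hmem : ∀ r, bind₁ c.toMvPolynomial (coeffForm n m ℂ (Γ r)) ∈
      Submodule.span ℂ (Set.range p)) :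
    LinearlyEquivalent (recMap Γ) (polyMap p) := by
  simp only [Submodule.mem_span_range_iff_exists_fun] at hmem
  obtain ⟨M, hM⟩ : ∃ M : Matrix (Fin n) (Fin n) ℂ,
      ∀ r, ∑ s, M r s • p s = bind₁ c.toMvPolynomial (coeffForm n m ℂ (Γ r)) :=
    Classical.skolem.1 hmem
  have hM_unit : IsUnit M := isUnit_of_bind₁_coeffForm_eq hc hΓ hM
  let L := M.toLinearEquiv' hM_unit.invertible
  refine ⟨L.symm, c.toLinearEquiv' hc.invertible, _root_.funext fun z ↦ ?_⟩
  exact L.eq_symm_apply.2 (recMap_mulVec_of_bind₁_coeffForm_eq hM z).symm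

end Reconstruction

end FinitePolyMap

theorem mainTheorem1 {n m : ℕ} (hn : 2 ≤ n) (hm : 2 ≤ m)
    (p : Fin n → MvPolynomial (Fin n) ℂ) (hp : ∀ r, (p r).IsHomogeneous m)
    (hfin : Module.Finite ℂ (FinitePolyMap.GermAlg p))
    {A : Type*} [CommRing A] [Algebra ℂ A] (e : A ≃ₐ[ℂ] FinitePolyMap.GermAlg p) :
    IsLocalRing A ∧
    ∀ 𝔪 : Ideal A, 𝔪.IsMaximal →
      n = Module.finrank ℂ 𝔪.Cotangent ∧
      (∃ ν : ℕ, FinitePolyMap.IsNilIndex 𝔪 ν ∧ n ∣ ν ∧ m = ν / n + 1) ∧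
      ∀ (E : Submodule ℂ 𝔪), IsCompl E (FinitePolyMap.subspaceIn 𝔪 (𝔪 ^ 2)) →
      ∀ (f : Module.Basis (Fin n) ℂ E)
        (S : Submodule ℂ ↥(𝔪 ^ m))
        (hS : IsCompl S (FinitePolyMap.subspaceIn (𝔪 ^ m) (𝔪 ^ (m + 1)))),
        (∃ Γ : Matrix (Fin n) (FinitePolyMap.MonoIdx n m) ℂ,
          FinitePolyMap.IsRelationMatrix 𝔪 (fun i => (f i : 𝔪)) S hS Γ) ∧
        ∀ Γ : Matrix (Fin n) (FinitePolyMap.MonoIdx n m) ℂ,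
          FinitePolyMap.IsRelationMatrix 𝔪 (fun i => (f i : 𝔪)) S hS Γ →
          FinitePolyMap.LinearlyEquivalent (FinitePolyMap.recMap Γ)
            (FinitePolyMap.polyMap p) := by
  obtain ⟨N, hN⟩ := FinitePolyMap.exists_pow_idealOfVars_le hp
  obtain ⟨φ, hφ, hker⟩ := FinitePolyMap.exists_surjective_algHom_ker_eq_span_range hp e
  have hle : RingHom.ker φ ≤ MvPolynomial.idealOfVars (Fin n) ℂ ^ 2 := hker.trans_le <|
    (FinitePolyMap.span_le_pow_idealOfVars (Set.forall_mem_range.2 hp)).trans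
      (Ideal.pow_le_pow_right hm)
  have hm0 : m ≠ 0 := by lia
  refine ⟨FinitePolyMap.isLocalRing_of_pow_idealOfVars_le_ker hφ (hker ▸ hN)
    (hle.trans (Ideal.pow_le_self two_ne_zero)), fun 𝔪 h𝔪 ↦ ?_⟩
  obtain rfl := FinitePolyMap.eq_map_idealOfVars_of_isMaximal hφ (hker ▸ hN) h𝔪
  have hnil := FinitePolyMap.isNilIndex_map_idealOfVars hm0 hp hker hN
  have hrank := FinitePolyMap.finrank_cotangent_map_idealOfVars hφ hle
  rw [Fintype.card_fin] at hnil hrank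
  refine ⟨hrank.symm, ⟨_, hnil, dvd_mul_right _ _, ?_⟩, fun E hE f S hS ↦ ?_⟩
  · rw [Nat.mul_div_cancel_left _ (by lia), Nat.sub_add_cancel (by lia)]
  obtain ⟨c, hcu, hc⟩ :=
    FinitePolyMap.exists_isUnit_sub_toMvPolynomial_mem hφ hle hE.disjoint f.linearIndependent
  have hrel := FinitePolyMap.sum_smul_projectionOnto_monoIn_eq_zero_iff_bind₁_mem_span
    hp hφ hker hc hS
  constructor
  · obtain ⟨Γ, hΓ, hΓp⟩ := FinitePolyMap.exists_linearIndependent_bind₁_coeffForm_eq hp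
      (FinitePolyMap.linearIndependent_of_pow_idealOfVars_le hm0 hp hN) hcu
    exact ⟨Γ, hΓ, fun r ↦ (hrel _).2 (hΓp r ▸ Submodule.subset_span ⟨r, rfl⟩)⟩
  · rintro Γ ⟨hΓ, hΓrel⟩
    exact FinitePolyMap.linearlyEquivalent_recMap_polyMap hcu hΓ fun r ↦ (hrel _).1 (hΓrel r)
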